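/- Let $K$ be an algebraically closed field of any characteristic, let $\mathbf m_1,\dots,\mathbf m_n\in\mathbb N^d$ and let $S=\mathbb N\{\mathbf m_1,\dots,\mathbf m_n\}\subseteq\mathbb N^d$ be the semigroup they generate. The toric ideal $I_S\subset K[x_1,\dots,x_n]$ is the ideal generated by all binomials $x_1^{a_1}\cdots x_n^{a_n}-x_1^{b_1}\cdots x_n^{b_n}$ with $\sum_i a_i\mathbf m_i=\sum_i b_i\mathbf m_i$; $V_S\subset\mathbb A^n$ is its zero set, and $V_{\overline S}\subset\mathbb P^n$ denotes the projective closure of $V_S$. Let $\mathbf m\in S$ and let $\ell$ be a positive integer that is relatively prime to some component of $\mathbf m$. Let $S_{\ell,\mathbf m}$ be the semigroup generated by $\ell\mathbf m_1,\dots,\ell\mathbf m_n,\mathbf m$, and let $V_{\overline S_{\ell,\mathbf m}}\subset\mathbb P^{n+1}$ be the projective closure of the affine toric variety $V_{S_{\ell,\mathbf m}}\subset\mathbb A^{n+1}$ (defined by these $n+1$ generators); it is called an extension of $V_{\overline S}$. Let $\delta(\mathbf m)$ be the minimum of the sums $s_1+\cdots+s_n$ over all non-negative integers $s_1,\dots,s_n$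 with $\mathbf m=s_1\mathbf m_1+\cdots+s_n\mathbf m_n$, and assume that $\ell\ge\delta(\mathbf m)$. Then: 1. if $V_{\overline S}\subset\mathbb P^n$ is a set-theoretic complete intersection (the common zero set of $\operatorname{codim} V_{\overline S}$ homogeneous polynomials), then so is $V_{\overline S_{\ell,\mathbf m}}\subset\mathbb P^{n+1}$; 2. if $V_{\overline S}$ is arithmetically Cohen--Macaulay (its homogeneous coordinate ring is Cohen--Macaulay), then so is $V_{\overline S_{\ell,\mathbf m}}$; 3. if $V_{\overline S}$ is arithmetically Gorenstein (its homogeneous coordinate ring is Gorenstein), then so is $V_{\overline S_{\ell,\mathbf m}}$. -/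

import Mathlib

open scoped LinearAlgebra.Projectivization

namespace ToricExt

noncomputable section

universe u

/-! ### Affine semigroups and affine toric varieties -/

section Affine

variable {n d : ℕ}

/-- The semigroup `S = ℕ{m₁, …, mₙ} ⊆ ℕᵈ` generated by a tuple `m` of vectors. -/
def semigroup (m : Fin n → Fin d → ℕ) : AddSubmonoid (Fin d → ℕ) :=
  AddSubmonoid.closure (Set.range m)

/-- The `S`-degree `b₁ m₁ + ⋯ + bₙ mₙ` of the monomial `x₁^{b₁} ⋯ xₙ^{bₙ}`. -/
def sDeg (m : Fin n → Fin d → ℕ) (b : Fin n →₀ ℕ) : Fin d → ℕ :=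
  ∑ i, b i • m i

/-- The toric ideal `I_S`, generated by the binomials `x^a - x^b` with equal `S`-degrees. -/
def toricIdeal (K : Type u) [Field K] (m : Fin n → Fin d → ℕ) :
    Ideal (MvPolynomial (Fin n) K) :=
  Ideal.span {f | ∃ a b : Fin n →₀ ℕ, sDeg m a = sDeg m b ∧
    f = MvPolynomial.monomial a 1 - MvPolynomial.monomial b 1}

/-- The affine toric variety `V_S ⊆ 𝔸ⁿ`. -/
def toricVariety (K : Type u) [Field K] (m : Fin n → Fin d → ℕ) : Set (Fin n → K) :=
  MvPolynomial.zeroLocus K (toricIdeal K m)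

/-- `δ(v)`: the minimum of the sums `s₁ + ⋯ + sₙ` over all representations
`v = s₁ m₁ + ⋯ + sₙ mₙ`. (Only used for `v ∈ S`, where such a representation exists.) -/
def delta (m : Fin n → Fin d → ℕ) (v : Fin d → ℕ) : ℕ :=
  sInf {N | ∃ s : Fin n → ℕ, v = ∑ i, s i • m i ∧ N = ∑ i, s i}

/-- The generators `ℓ m₁, …, ℓ mₙ, v` of the semigroup `S_{ℓ,v}`. -/
def extGens (m : Fin n → Fin d → ℕ) (ℓ : ℕ) (v : Fin d → ℕ) : Fin (n + 1) → Fin d → ℕ :=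
  Fin.snoc (α := fun _ => Fin d → ℕ) (fun i => ℓ • m i) v

/-- The condition for `V_{S_{ℓ,v}} ⊆ 𝔸ⁿ⁺¹` to be an extension of `V_S ⊆ 𝔸ⁿ`: `v ∈ S`, and `ℓ` is
a positive integer relatively prime to a component of `v`. -/
structure IsExtension (m : Fin n → Fin d → ℕ) (ℓ : ℕ) (v : Fin d → ℕ) : Prop where
  mem : v ∈ semigroup m
  pos : 0 < ℓ
  coprime : ∃ j, Nat.Coprime ℓ (v j)

end Affine

/-! ### Projective varieties -/

section Projective

variable {K : Type u} [Field K] {n : ℕ}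

/-- The common zeros in `ℙⁿ` of a set of homogeneous polynomials in `x₀, …, xₙ`. -/
def projZeroLocus (s : Set (MvPolynomial (Fin (n + 1)) K)) : Set (ℙ K (Fin (n + 1) → K)) :=
  {p | ∀ f ∈ s, MvPolynomial.eval p.rep f = 0}

/-- The homogeneous polynomials that vanish on a subset of `ℙⁿ`. -/
def homVanishing (X : Set (ℙ K (Fin (n + 1) → K))) : Set (MvPolynomial (Fin (n + 1)) K) :=
  {f | (∃ k, f.IsHomogeneous k) ∧ ∀ p ∈ X, MvPolynomial.eval p.rep f = 0}

/-- The homogeneous ideal of a subset of `ℙⁿ`. -/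
def homIdeal (X : Set (ℙ K (Fin (n + 1) → K))) : Ideal (MvPolynomial (Fin (n + 1)) K) :=
  Ideal.span (homVanishing X)

/-- The homogeneous coordinate ring of a subset of `ℙⁿ`. -/
abbrev HomCoordRing (X : Set (ℙ K (Fin (n + 1) → K))) : Type u :=
  MvPolynomial (Fin (n + 1)) K ⧸ homIdeal X

/-- The standard open embedding `𝔸ⁿ → ℙⁿ`, `a ↦ (1 : a₁ : ⋯ : aₙ)`. -/
def affineToProj (a : Fin n → K) : ℙ K (Fin (n + 1) → K) :=
  Projectivization.mk K (Fin.cons (α := fun _ => K) 1 a) fun h =>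
    one_ne_zero (α := K) (by simpa using congrFun h 0)

/-- The projective closure in `ℙⁿ` of a subset of `𝔸ⁿ`: its Zariski closure. -/
def projClosure (X : Set (Fin n → K)) : Set (ℙ K (Fin (n + 1) → K)) :=
  projZeroLocus (homVanishing (affineToProj '' X))

/-- A nonempty projective variety `V ⊆ ℙⁿ` is a set-theoretic complete intersection if it is the
common zero set of `c = codim V` homogeneous polynomials. As the homogeneous coordinate ring has
Krull dimension `dim V + 1`, the equality `c = n - dim V` reads
`c + dim (homogeneous coordinate ring) = n + 1`. -/
def IsSetTheoreticCI (V : Set (ℙ K (Fin (n + 1) → K))) : Prop :=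
  ∃ (c : ℕ) (f : Fin c → MvPolynomial (Fin (n + 1)) K),
    (∀ i, ∃ k, (f i).IsHomogeneous k) ∧
    V = projZeroLocus (Set.range f) ∧
    (c : WithBot ℕ∞) + ringKrullDim (HomCoordRing V) = ((n + 1 : ℕ) : WithBot ℕ∞)

end Projective

/-! ### Cohen–Macaulay and Gorenstein rings -/

section Rings

/-- A Noetherian local ring is Cohen–Macaulay if its depth equals its dimension, i.e. the maximal
ideal contains a regular sequence whose length is the Krull dimension. -/
def IsCohenMacaulayLocal (R : Type u) [CommRing R] [IsLocalRing R] : Prop :=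
  IsNoetherianRing R ∧ ∃ rs : List R, (∀ r ∈ rs, r ∈ IsLocalRing.maximalIdeal R) ∧
    RingTheory.Sequence.IsRegular R rs ∧ (rs.length : WithBot ℕ∞) = ringKrullDim R

/-- A Noetherian local ring is Gorenstein if it has finite injective dimension as a module over
itself. -/
def IsGorensteinLocal (R : Type u) [CommRing R] [IsLocalRing R] : Prop :=
  IsNoetherianRing R ∧
    ∃ k : ℕ, CategoryTheory.HasInjectiveDimensionLE (ModuleCat.of.{u} R R) k

/-- A Noetherian ring is Cohen–Macaulay if its localizations at maximal ideals are. -/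
def IsCohenMacaulay (R : Type u) [CommRing R] : Prop :=
  IsNoetherianRing R ∧ ∀ (p : Ideal R) [p.IsMaximal],
    IsCohenMacaulayLocal (Localization.AtPrime p)

/-- A Noetherian ring is Gorenstein if its localizations at maximal ideals are. -/
def IsGorenstein (R : Type u) [CommRing R] : Prop :=
  IsNoetherianRing R ∧ ∀ (p : Ideal R) [p.IsMaximal],
    IsGorensteinLocal (Localization.AtPrime p)

end Rings

section Arithmetic

variable {K : Type u} [Field K] {n : ℕ}

/-- `V ⊆ ℙⁿ` is arithmetically Cohen–Macaulay: its homogeneous coordinate ring is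
Cohen–Macaulay. -/
def IsArithCM (V : Set (ℙ K (Fin (n + 1) → K))) : Prop :=
  IsCohenMacaulay (HomCoordRing V)

/-- `V ⊆ ℙⁿ` is arithmetically Gorenstein: its homogeneous coordinate ring is Gorenstein. -/
def IsArithGorenstein (V : Set (ℙ K (Fin (n + 1) → K))) : Prop :=
  IsGorenstein (HomCoordRing V)

/-- The projective toric variety `V_{S̄} ⊆ ℙⁿ`: the projective closure of `V_S ⊆ 𝔸ⁿ`. -/
def projToricVariety {d : ℕ} (K : Type u) [Field K] (m : Fin n → Fin d → ℕ) :
    Set (ℙ K (Fin (n + 1) → K)) :=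
  projClosure (toricVariety K m)

end Arithmetic

end

end ToricExt

/-! Let `A` and `B` be the homogeneous coordinate rings of the toric variety and of its extension,
and let `y` be the class of the new variable. The whole theorem rests on one fact: `B` is free over
`A` with basis `1, y, …, y^(ℓ-1)`, and `y^ℓ = g` for a monomial `g` from `A` (`exists_root_basis`).
Since `ℓ ≥ δ(v)`, a shortest representation of `v` can be padded with a power of `x₀` to a monomial
of degree exactly `ℓ`; this gives the relation and the spanning. Independence holds because `ℓ` is
prime to a component of `v`, so the exponent of `y` modulo `ℓ` can be read off the multidegree.

Being free and finite, `A → B` preserves Krull dimension, so the codimension grows by one, and the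
single equation `y^ℓ = g` cuts the extension out of the cone over the old variety. Flatness carries
regular sequences from `A` to `B`, which gives the Cohen–Macaulay case. For the Gorenstein case,
`Hom_A(B, A) ≅ B`, generated by the coefficient of `y^(ℓ-1)`, and coextension along a projective
algebra does not raise injective dimension. -/

namespace ToricExt

/-! ### Dimension and Cohen–Macaulayness along flat integral extensions. -/

section FlatIntegral

variable {R S : Type*} [CommRing R] [CommRing S] [Algebra R S] [Algebra.IsIntegral R S]

/-- Incomparability makes contraction of primes strictly monotone, so chains below `P` contract to
chains of the same length. -/
theorem height_le_of_liesOver_of_isIntegral (p : Ideal R) [p.IsPrime] (P : Ideal S) [P.IsPrime]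
    [hP : P.LiesOver p] : P.height ≤ p.height := by
  have hmono : StrictMono (PrimeSpectrum.comap (algebraMap R S)) := fun I J h =>
    Ideal.IsIntegral.comap_lt_comap (I := I.asIdeal) (J := J.asIdeal) h
  have := Order.height_le_height_apply_of_strictMono _ hmono ⟨P, ‹_›⟩
  rw [← PrimeSpectrum.height_eq_orderHeight, ← PrimeSpectrum.height_eq_orderHeight] at this
  rw [hP.over]
  exact this

variable [IsNoetherianRing R] [IsNoetherianRing S]

theorem height_eq_of_liesOver_of_flat_of_isIntegral [Module.Flat R S] (p : Ideal R) [p.IsPrime]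
    (P : Ideal S) [P.IsPrime] [P.LiesOver p] : P.height = p.height :=
  le_antisymm (height_le_of_liesOver_of_isIntegral p P) <| by
    rw [Ideal.height_eq_height_add_of_liesOver_of_hasGoingDown p P]
    exact le_self_add

theorem ringKrullDim_eq_of_faithfullyFlat_of_isIntegral [Module.FaithfullyFlat R S] :
    ringKrullDim S = ringKrullDim R := by
  apply le_antisymm
  · rw [ringKrullDim_le_iff_height_le]
    intro P hP
    rw [height_eq_of_liesOver_of_flat_of_isIntegral (P.under R) P]
    exact Ideal.height_le_ringKrullDim_of_isPrime
  · rw [ringKrullDim_le_iff_height_le]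
    intro p hp
    obtain ⟨P, hP, hPp⟩ := Ideal.exists_isPrime_liesOver_of_faithfullyFlat (B := S) p
    rw [← height_eq_of_liesOver_of_flat_of_isIntegral p P]
    exact Ideal.height_le_ringKrullDim_of_isPrime

end FlatIntegral

universe u

/-- A maximal regular sequence at the contraction of `P` stays weakly regular by flatness, lies in
the maximal ideal because the map is local, and has the right length because the heights agree. -/
theorem isCohenMacaulay_of_flat_of_isIntegral {R S : Type u} [CommRing R] [CommRing S]
    [Algebra R S] [Module.Flat R S] [Algebra.IsIntegral R S] [IsNoetherianRing S]
    (h : IsCohenMacaulay R) : IsCohenMacaulay S := by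
  have := h.1
  refine ⟨inferInstance, fun P hP => ⟨inferInstance, ?_⟩⟩
  have hp : (P.under R).IsMaximal := Ideal.isMaximal_comap_of_isIntegral_of_isMaximal P
  obtain ⟨-, rs, hmem, hreg, hlen⟩ := h.2 (P.under R)
  set f := Localization.localRingHom (P.under R) P (algebraMap R S) rfl with hf
  have hflat : f.Flat := RingHom.Flat.localRingHom
    (f := algebraMap R S) (RingHom.flat_algebraMap_iff.mpr ‹_›) P _ rfl
  let _ := f.toAlgebra
  have : Module.Flat (Localization.AtPrime (P.under R)) (Localization.AtPrime P) := hflat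
  have hmem' : ∀ r ∈ rs.map f, r ∈ IsLocalRing.maximalIdeal (Localization.AtPrime P) := by
    intro r hr
    obtain ⟨a, ha, rfl⟩ := List.mem_map.mp hr
    have : IsLocalHom f := Localization.isLocalHom_localRingHom _ _ _ rfl
    exact IsLocalRing.map_maximalIdeal_le f (Ideal.mem_map_of_mem f (hmem a ha))
  refine ⟨rs.map f, hmem', ?_, ?_⟩
  · rw [IsLocalRing.isRegular_iff_isWeaklyRegular_of_subset_maximalIdeal hmem']
    exact hreg.1.of_flat
  · rw [List.length_map, hlen, IsLocalization.AtPrime.ringKrullDim_eq_height (P.under R),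
      IsLocalization.AtPrime.ringKrullDim_eq_height P,
      height_eq_of_liesOver_of_flat_of_isIntegral (P.under R) P]

open CategoryTheory

/-! ### Injective dimension under coextension of scalars. -/

section Coextension

variable {A B : Type u} [CommRing A] [CommRing B] [Algebra A B]

/-- Dimension shifting along `0 → M → I → I/M → 0`: coextension preserves injectives, being right
adjoint to restriction, and is exact because `B` is projective over `A`. -/
theorem hasInjectiveDimensionLE_coextendScalars [Module.Projective A B] (k : ℕ)
    (M : ModuleCat.{u} A) [HasInjectiveDimensionLE M k] :
    HasInjectiveDimensionLE ((ModuleCat.coextendScalars (algebraMap A B)).obj M) k := by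
  induction k generalizing M with
  | zero =>
    have h : HasInjectiveDimensionLE M 0 := ‹_›
    simp only [HasInjectiveDimensionLE, zero_add, ← injective_iff_hasInjectiveDimensionLT_one]
      at h ⊢
    exact Injective.injective_of_adjoint (ModuleCat.restrictCoextendScalarsAdj (algebraMap A B)) M
  | succ k ih =>
    obtain ⟨I, hI, f, hf⟩ := EnoughInjectives.presentation M
    have hfi : Function.Injective f.hom := (ModuleCat.mono_iff_injective f).mp ‹_›
    let S : ShortComplex (ModuleCat.{u} A) :=
      ModuleCat.shortComplexOfCompEqZero _ _ f.hom.exact_map_mkQ_range.linearMap_comp_eq_zero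
    have hS : S.ShortExact := ModuleCat.shortComplex_shortExact S
      f.hom.exact_map_mkQ_range hfi (Submodule.mkQ_surjective _)
    have := (hS.hasInjectiveDimensionLT_X₃_iff k hI).mpr ‹_›
    let G := ModuleCat.coextendScalars.{u, u, u} (algebraMap A B)
    have hT : (S.map G).ShortExact := by
      refine ModuleCat.shortComplex_shortExact _ (fun x => ⟨fun hx => ?_, ?_⟩)
        (fun x x' hx => ?_) (fun x => ?_)
      · let x' := ModuleCat.CoextendScalars.equiv (algebraMap A B) _ x
        have hx' : ∀ b, x' b ∈ LinearMap.range f.hom := fun b => by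
          have := congrArg (fun z => ModuleCat.CoextendScalars.equiv (algebraMap A B) _ z b) hx
          exact (Submodule.Quotient.mk_eq_zero _).mp this
        let e := LinearEquiv.ofInjective f.hom hfi
        refine ⟨(ModuleCat.CoextendScalars.equiv (algebraMap A B) M).symm
          (e.symm.toLinearMap ∘ₗ x'.codRestrict _ hx'), ?_⟩
        refine ModuleCat.CoextendScalars.ext (LinearMap.ext fun b => ?_)
        exact congrArg Subtype.val (e.apply_symm_apply ⟨x' b, hx' b⟩)
      · rintro ⟨z, rfl⟩
        refine ModuleCat.CoextendScalars.ext (LinearMap.ext fun b => ?_)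
        exact (Submodule.Quotient.mk_eq_zero _).mpr ⟨_, rfl⟩
      · refine ModuleCat.CoextendScalars.ext (LinearMap.ext fun b => hfi ?_)
        exact congrArg (fun z => ModuleCat.CoextendScalars.equiv (algebraMap A B) _ z b) hx
      · let x' := ModuleCat.CoextendScalars.equiv (algebraMap A B) _ x
        have hproj : Module.Projective A
            ((ModuleCat.restrictScalars (algebraMap A B)).obj (ModuleCat.of B B)) := by
          -- The restricted module structure on `B` and the one from the algebra must be identified
          -- before projectivity applies.
          have hr : Module.compHom B (algebraMap A B) = (Algebra.toModule : Module A B) :=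
            Module.ext' _ _ fun r x => (Algebra.smul_def r x).symm
          change @Module.Projective A _ B _ (Module.compHom B (algebraMap A B))
          rw [hr]
          infer_instance
        obtain ⟨z, hz⟩ := Module.projective_lifting_property (LinearMap.range f.hom).mkQ x'
          (Submodule.mkQ_surjective _)
        refine ⟨(ModuleCat.CoextendScalars.equiv (algebraMap A B) I).symm z, ?_⟩
        refine ModuleCat.CoextendScalars.ext (LinearMap.ext fun b => ?_)
        exact LinearMap.congr_fun hz b
    have hinj : Injective (S.map G).X₂ :=
      Injective.injective_of_adjoint (ModuleCat.restrictCoextendScalarsAdj (algebraMap A B)) I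
    exact (hT.hasInjectiveDimensionLT_X₃_iff k hinj).mp (ih S.X₃)

end Coextension

/-! ### Adjoining a root preserves the Gorenstein property. -/

section RootBasis

variable {A B : Type u} [CommRing A] [CommRing B] [Algebra A B]

/-- The families `y^j` and `y^(ℓ-1-i)` are dual for the form given by the coefficient of `y^(ℓ-1)`.
For `j > i` the product is `g • y^(j-i-1)`, whose exponent is below `ℓ-1`. -/
theorem root_coord_duality {ℓ : ℕ} (hℓ : 0 < ℓ) {y : B} {g : A} (b : Module.Basis (Fin ℓ) A B)
    (hb : ∀ i, b i = y ^ (i : ℕ)) (hy : y ^ ℓ = algebraMap A B g) (i j : Fin ℓ) :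
    b.coord ⟨ℓ - 1, by omega⟩ (y ^ (j : ℕ) * y ^ (ℓ - 1 - (i : ℕ))) = if j = i then 1 else 0 := by
  rw [← pow_add]
  rcases lt_trichotomy (j : ℕ) i with h | h | h
  · rw [if_neg (by rintro rfl; omega)]
    have := hb ⟨j + (ℓ - 1 - i), by omega⟩
    rw [← this, Module.Basis.coord_apply, Module.Basis.repr_self, Finsupp.single_apply_eq_zero]
    intro h'; simp at h'; omega
  · rw [if_pos (Fin.ext h)]
    have := hb ⟨j + (ℓ - 1 - i), by omega⟩
    rw [← this, Module.Basis.coord_apply, Module.Basis.repr_self]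
    have : (⟨j + (ℓ - 1 - i), by omega⟩ : Fin ℓ) = ⟨ℓ - 1, by omega⟩ := Fin.ext (by simp; omega)
    rw [this, Finsupp.single_eq_same]
  · rw [if_neg (by rintro rfl; omega)]
    have e : (j : ℕ) + (ℓ - 1 - i) = ℓ + (j - i - 1) := by omega
    have := hb ⟨j - i - 1, by omega⟩
    rw [e, pow_add, hy, ← this, ← Algebra.smul_def, map_smul, Module.Basis.coord_apply,
      Module.Basis.repr_self, Finsupp.single_eq_of_ne, smul_zero]
    intro h'; simp at h'; omega

/-- By the duality, the functional `c` generates `Hom_A(B, A)` freely over `B`, so `B` is the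
coextension of `A`. -/
theorem root_hasInjectiveDimensionLE {ℓ : ℕ} (hℓ : 0 < ℓ) {y : B} {g : A}
    (b : Module.Basis (Fin ℓ) A B)
    (hb : ∀ i, b i = y ^ (i : ℕ)) (hy : y ^ ℓ = algebraMap A B g) (k : ℕ)
    [HasInjectiveDimensionLE (ModuleCat.of A A) k] :
    HasInjectiveDimensionLE (ModuleCat.of B B) k := by
  have : Module.Free A B := .of_basis b
  have := hasInjectiveDimensionLE_coextendScalars (B := B) k (ModuleCat.of A A)
  let c := b.coord ⟨ℓ - 1, by omega⟩
  have hdual := root_coord_duality hℓ b hb hy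
  let G := (ModuleCat.coextendScalars.{u, u, u} (algebraMap A B)).obj (ModuleCat.of A A)
  let E := ModuleCat.CoextendScalars.equiv.{u, u, u} (algebraMap A B) (ModuleCat.of A A)
  let c' : G := E.symm
    { toFun := c, map_add' := c.map_add, map_smul' := fun r (x : B) => by
        have : c (algebraMap A B r * x) = r * c x := by
          rw [← Algebra.smul_def, map_smul, smul_eq_mul]
        exact this }
  have hcoe (z x : B) : E (z • c') x = c (x * z) := rfl
  have hbij : Function.Bijective (LinearMap.toSpanSingleton B G c') := by
    constructor
    · rw [← LinearMap.ker_eq_bot, LinearMap.ker_eq_bot']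
      intro z hz
      have hz' : ∀ x : B, c (x * z) = 0 := fun x => by
        rw [← hcoe]
        exact LinearMap.congr_fun (congrArg E hz) x
      refine b.ext_elem fun i => ?_
      -- Testing against the dual basis element isolates the `i`-th coordinate of `z`.
      have := hz' (y ^ (ℓ - 1 - (i : ℕ)))
      rw [← b.sum_repr z, Finset.mul_sum, map_sum] at this
      simp_rw [mul_smul_comm, map_smul, hb, mul_comm (y ^ (ℓ - 1 - (i : ℕ))), c, hdual] at this
      simpa using this
    · intro φ
      refine ⟨∑ i : Fin ℓ, (E φ (y ^ (i : ℕ)) : A) • y ^ (ℓ - 1 - (i : ℕ)), ?_⟩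
      set z : B := ∑ i : Fin ℓ, (E φ (y ^ (i : ℕ)) : A) • y ^ (ℓ - 1 - (i : ℕ)) with hz
      let φ' : B →ₗ[A] A :=
        { toFun := E φ, map_add' := (E φ).map_add, map_smul' := fun r (x : B) =>
            (congrArg (E φ) (Algebra.smul_def r x)).trans ((E φ).map_smul r x) }
      have h : c ∘ₗ LinearMap.mulRight A z = φ' := b.ext fun j => by
        change c (b j * z) = E φ (b j)
        rw [hb, hz, Finset.mul_sum, map_sum]
        simp_rw [mul_smul_comm, map_smul, c, hdual]
        simp
      refine E.injective (LinearMap.ext fun x => ?_)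
      exact (hcoe z x).trans (LinearMap.congr_fun h x)
  exact (ModuleCat.hasInjectiveDimensionLE_iff_of_linearEquiv
    (LinearEquiv.ofBijective _ hbij) k).mpr this

end RootBasis

attribute [local instance] RingHomInvPair.of_ringEquiv in
theorem hasInjectiveDimensionLE_of_isLocalizedModule {B T : Type u} [CommRing B] [CommRing T]
    [Algebra B T] [IsNoetherianRing B] (S : Submonoid B) [IsLocalization S T] (k : ℕ)
    (M : ModuleCat.{u} B) {N : Type u} [AddCommGroup N] [Module B N] [Module T N]
    [IsScalarTower B T N] (f : M →ₗ[B] N) [IsLocalizedModule S f] [HasInjectiveDimensionLE M k] :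
    HasInjectiveDimensionLE (ModuleCat.of T N) k := by
  have h := ModuleCat.localizedModule_hasInjectiveDimensionLE k S M
  let eR := IsLocalization.algEquiv S (Localization S) T
  let e₁ := IsLocalizedModule.linearEquiv S (M.localizedModuleMkLinearMap S) f
  let e : M.localizedModule S ≃ₛₗ[RingHomClass.toRingHom eR.toRingEquiv] ModuleCat.of T N :=
    { e₁ with
      map_smul' := fun r x => by
        obtain ⟨a, s, rfl⟩ := IsLocalization.exists_mk'_eq S r
        apply IsLocalizedModule.smul_injective f s
        change s.1 • e₁ (IsLocalization.mk' (Localization S) a s • x) =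
          s.1 • (eR (IsLocalization.mk' (Localization S) a s) • e₁ x : N)
        rw [← map_smul, ← smul_assoc, ← smul_assoc, IsLocalization.algEquiv_mk',
          Algebra.smul_def, IsLocalization.mk'_spec', Algebra.smul_def, IsLocalization.mk'_spec',
          algebraMap_smul, algebraMap_smul, map_smul] }
  exact (ModuleCat.hasInjectiveDimensionLE_iff_of_semiLinearEquiv _ e k).mp h

/-- Localizing at the complement of the contracted prime keeps the root basis, and the local ring at
`P` is a further localization. -/
theorem isGorenstein_of_root {R S : Type u} [CommRing R] [CommRing S] [Algebra R S]
    {ℓ : ℕ} (hℓ : 0 < ℓ) {y : S} {g : R} (b : Module.Basis (Fin ℓ) R S)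
    (hb : ∀ i, b i = y ^ (i : ℕ)) (hy : y ^ ℓ = algebraMap R S g) (h : IsGorenstein R) :
    IsGorenstein S := by
  have := h.1
  have : Module.Finite R S := .of_basis b
  have : IsNoetherianRing S := IsNoetherianRing.of_finite R S
  refine ⟨‹_›, fun P hP => ⟨inferInstance, ?_⟩⟩
  have hp : (P.under R).IsMaximal := Ideal.isMaximal_comap_of_isIntegral_of_isMaximal P
  obtain ⟨-, k, hk⟩ := h.2 (P.under R)
  refine ⟨k, ?_⟩
  let M := (P.under R).primeCompl
  let A := Localization.AtPrime (P.under R)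
  let N := Algebra.algebraMapSubmonoid S M
  let B := Localization N
  let bB := b.localizationLocalization A M B
  have hN : N ≤ P.primeCompl := by
    rintro _ ⟨x, hx, rfl⟩
    exact hx
  let _ : Algebra B (Localization.AtPrime P) :=
    IsLocalization.localizationAlgebraOfSubmonoidLe _ _ N P.primeCompl hN
  have : IsScalarTower S B (Localization.AtPrime P) :=
    IsLocalization.localization_isScalarTower_of_submonoid_le ..
  have : HasInjectiveDimensionLE (ModuleCat.of B B) k := by
    refine root_hasInjectiveDimensionLE (A := A) (y := algebraMap S B y) (g := algebraMap R A g)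
      hℓ bB (fun i => ?_) ?_ k
    · rw [Module.Basis.localizationLocalization_apply, hb, map_pow]
    · rw [← map_pow, hy, ← IsScalarTower.algebraMap_apply, ← IsScalarTower.algebraMap_apply]
  have : IsNoetherianRing B := IsLocalization.isNoetherianRing N B ‹_›
  have := IsLocalization.isLocalization_of_submonoid_le B (Localization.AtPrime P) N _ hN
  exact hasInjectiveDimensionLE_of_isLocalizedModule (P.primeCompl.map (algebraMap S B)) k
    (ModuleCat.of B B) (Algebra.linearMap B (Localization.AtPrime P))

open MvPolynomial

/-! ### Kernels of monomial maps. -/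

section MonomialMap

variable {σ τ : Type*} (K : Type*) [Field K] (W : σ → τ →₀ ℕ)

/-- The homomorphism that sends the variable `xᵢ` to the monomial with exponent `W i`. -/
noncomputable def monomialHom : MvPolynomial σ K →ₐ[K] MvPolynomial τ K :=
  aeval fun i => monomial (W i) 1

theorem monomialHom_X (i : σ) : monomialHom K W (X i) = monomial (W i) 1 := by
  simp [monomialHom]

theorem monomialHom_monomial (a : σ →₀ ℕ) (c : K) :
    monomialHom K W (monomial a c) = monomial (Finsupp.linearCombination ℕ W a) c := by
  rw [monomialHom, aeval_monomial, Finsupp.linearCombination_apply]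
  simp_rw [monomial_pow, one_pow]
  rw [algebraMap_eq, ← monomial_finsupp_sum_index]

/-- The binomials in the kernel of a monomial map. -/
def kerBinomials : Set (MvPolynomial σ K) :=
  {f | ∃ a b : σ →₀ ℕ, Finsupp.linearCombination ℕ W a = Finsupp.linearCombination ℕ W b ∧
    f = monomial a 1 - monomial b 1}

/-- Let `s` send each exponent in the image to a chosen preimage. Then `f - s(φ f)` is a combination
of binomials, as is checked on monomials, and it equals `f` on the kernel of `φ`. The values of `s`
off the image play no role. -/
theorem ker_monomialHom :
    RingHom.ker (monomialHom K W) = Ideal.span (kerBinomials K W) := by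
  classical
  apply le_antisymm
  · let D : (σ →₀ ℕ) → (τ →₀ ℕ) := Finsupp.linearCombination ℕ W
    let s : MvPolynomial τ K →ₗ[K] MvPolynomial σ K :=
      (basisMonomials τ K).constr K fun g => monomial (Function.invFun D g) 1
    have hs : ∀ g c, s (monomial g c) = monomial (Function.invFun D g) c := fun g c => by
      have : (monomial g c : MvPolynomial τ K) = c • basisMonomials τ K g := by
        simp [smul_monomial]
      rw [this, map_smul, Module.Basis.constr_basis, smul_monomial, smul_eq_mul, mul_one]
    have key : ∀ f, f - s (monomialHom K W f) ∈ Ideal.span (kerBinomials K W) := by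
      intro f
      induction f using MvPolynomial.induction_on' with
      | monomial a c =>
        rw [monomialHom_monomial, hs]
        have h : D (Function.invFun D (D a)) = D a := Function.invFun_eq ⟨a, rfl⟩
        have e : monomial a c - monomial (Function.invFun D (D a)) c =
            C c * (monomial a 1 - monomial (Function.invFun D (D a)) 1) := by
          simp [mul_sub, C_mul_monomial]
        rw [show Finsupp.linearCombination ℕ W a = D a from rfl, e]
        exact Ideal.mul_mem_left _ _ (Ideal.subset_span ⟨_, _, h.symm, rfl⟩)
      | add p q hp hq =>
        rw [map_add, map_add, add_sub_add_comm]
        exact add_mem hp hq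
    intro f hf
    have := key f
    rwa [(RingHom.mem_ker).mp hf, map_zero, sub_zero] at this
  · rw [Ideal.span_le]
    rintro _ ⟨a, b, hab, rfl⟩
    simp [RingHom.mem_ker, monomialHom_monomial, hab]

theorem eval_monomialHom (t : τ → K) (f : MvPolynomial σ K) :
    eval t (monomialHom K W f) = eval (fun i => (W i).prod fun o k => t o ^ k) f := by
  induction f using MvPolynomial.induction_on with
  | C c => simp [monomialHom, algebraMap_eq]
  | add p q hp hq => simp [hp, hq]
  | mul_X p i hp => rw [map_mul, map_mul, hp, monomialHom_X, eval_monomial]; simp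

end MonomialMap

/-! ### Homogeneous polynomials on projective space. -/

section Homogeneous

variable {K : Type*} [Field K]

theorem eval_mul_of_isHomogeneous {σ : Type*} {f : MvPolynomial σ K} {k : ℕ}
    (hf : f.IsHomogeneous k) (c : K) (x : σ → K) :
    eval (fun i => c * x i) f = c ^ k * eval x f := by
  rw [eval_eq, eval_eq, Finset.mul_sum]
  refine Finset.sum_congr rfl fun a ha => ?_
  have hk : ∑ i ∈ a.support, a i = k := by
    rw [← Finsupp.degree_apply, Finsupp.degree_eq_weight_one]
    exact hf (mem_support_iff.mp ha)
  simp_rw [mul_pow, Finset.prod_mul_distrib, Finset.prod_pow_eq_pow_sum, hk]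
  ring

variable {n : ℕ}

theorem eval_rep_mk_eq_zero_iff {f : MvPolynomial (Fin (n + 1)) K} {k : ℕ}
    (hf : f.IsHomogeneous k) {x : Fin (n + 1) → K} (hx : x ≠ 0) :
    eval (Projectivization.mk K x hx).rep f = 0 ↔ eval x f = 0 := by
  obtain ⟨c, hc⟩ := Projectivization.exists_smul_eq_mk_rep K x hx
  rw [← hc]
  change eval (fun i => (c : K) * x i) f = 0 ↔ _
  rw [eval_mul_of_isHomogeneous hf]
  simp

theorem mk_mem_projZeroLocus_iff {s : Set (MvPolynomial (Fin (n + 1)) K)}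
    (hs : ∀ f ∈ s, ∃ k, f.IsHomogeneous k) {x : Fin (n + 1) → K} (hx : x ≠ 0) :
    Projectivization.mk K x hx ∈ projZeroLocus s ↔ ∀ f ∈ s, eval x f = 0 := by
  refine forall₂_congr fun f hf => ?_
  obtain ⟨k, hk⟩ := hs f hf
  exact eval_rep_mk_eq_zero_iff hk hx

theorem homVanishing_projZeroLocus_homVanishing (X : Set (ℙ K (Fin (n + 1) → K))) :
    homVanishing (projZeroLocus (homVanishing X)) = homVanishing X := by
  ext f
  exact ⟨fun h => ⟨h.1, fun p hp => h.2 p fun g hg => hg.2 p hp⟩,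
    fun h => ⟨h.1, fun p hp => hp f h⟩⟩

end Homogeneous

/-! ### The homogeneous ideal of a projective toric variety. -/

section HomogeneousToric

variable {n d : ℕ}

/-- The exponents of the monomial parametrisation of the cone over `V_{S̄}`: the generators
`(1, 0), (1, m₁), …, (1, mₙ)`. -/
noncomputable def homGens (m : Fin n → Fin d → ℕ) : Fin (n + 1) → Option (Fin d) →₀ ℕ := fun i =>
  Finsupp.equivFunOnFinite.symm fun o =>
    o.elim 1 ((Fin.cons 0 m : Fin (n + 1) → Fin d → ℕ) i)

theorem homGens_none (m : Fin n → Fin d → ℕ) (i) : homGens m i none = 1 := rfl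

theorem homGens_zero_some (m : Fin n → Fin d → ℕ) (j) : homGens m 0 (some j) = 0 := rfl

theorem homGens_succ_some (m : Fin n → Fin d → ℕ) (i j) :
    homGens m (Fin.succ i) (some j) = m i j := rfl

theorem linearCombination_homGens_none (m : Fin n → Fin d → ℕ) (a : Fin (n + 1) →₀ ℕ) :
    Finsupp.linearCombination ℕ (homGens m) a none = a.degree := by
  rw [Finsupp.linearCombination_apply, Finsupp.sum_fintype _ _ (by simp), Finsupp.finsetSum_apply,
    Finsupp.degree_eq_sum]
  simp [homGens_none]

theorem linearCombination_homGens_some (m : Fin n → Fin d → ℕ) (a : Fin (n + 1) →₀ ℕ) (j) :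
    Finsupp.linearCombination ℕ (homGens m) a (some j) = ∑ i, a (Fin.succ i) * m i j := by
  rw [Finsupp.linearCombination_apply, Finsupp.sum_fintype _ _ (by simp), Finsupp.finsetSum_apply,
    Fin.sum_univ_succ]
  simp [homGens_zero_some, homGens_succ_some]

variable {K : Type*} [Field K] (m : Fin n → Fin d → ℕ)

theorem exists_isHomogeneous_of_mem_kerBinomials {f : MvPolynomial (Fin (n + 1)) K}
    (hf : f ∈ kerBinomials K (homGens m)) : ∃ k, f.IsHomogeneous k := by
  obtain ⟨a, b, hab, rfl⟩ := hf
  have h := DFunLike.congr_fun hab none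
  rw [linearCombination_homGens_none, linearCombination_homGens_none] at h
  exact ⟨a.degree, (isHomogeneous_monomial _ rfl).sub (isHomogeneous_monomial _ h.symm)⟩

theorem kerBinomials_subset_homVanishing :
    kerBinomials K (homGens m) ⊆ homVanishing (affineToProj '' toricVariety K m) := by
  intro f hf
  refine ⟨exists_isHomogeneous_of_mem_kerBinomials m hf, ?_⟩
  obtain ⟨k, hk⟩ := exists_isHomogeneous_of_mem_kerBinomials m hf
  rintro _ ⟨x, hx, rfl⟩
  refine (eval_rep_mk_eq_zero_iff hk _).mpr ?_
  obtain ⟨a, b, hab, rfl⟩ := hf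
  have := hx (monomial a.tail 1 - monomial b.tail 1) <| Ideal.subset_span ⟨_, _, ?_, rfl⟩
  · rw [map_sub, sub_eq_zero, aeval_monomial, aeval_monomial,
      Finsupp.prod_fintype _ _ (by simp), Finsupp.prod_fintype _ _ (by simp)] at this
    rw [map_sub, sub_eq_zero, eval_monomial, eval_monomial,
      Finsupp.prod_fintype _ _ (by simp), Finsupp.prod_fintype _ _ (by simp),
      Fin.prod_univ_succ, Fin.prod_univ_succ]
    simpa [Finsupp.tail_apply] using this
  · ext j
    have h := DFunLike.congr_fun hab (some j)
    rw [linearCombination_homGens_some, linearCombination_homGens_some] at h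
    simpa [sDeg, Finsupp.tail_apply] using h

/-- The points `(t^(m₁), …, t^(mₙ))` lie on `V_S`, so by homogeneity the pullback of `f` to the
parameters vanishes everywhere; over an infinite field it is the zero polynomial. -/
theorem homVanishing_subset_ker [Infinite K] {f : MvPolynomial (Fin (n + 1)) K}
    (hf : f ∈ homVanishing (affineToProj '' toricVariety K m)) :
    f ∈ RingHom.ker (monomialHom K (homGens m)) := by
  obtain ⟨⟨k, hk⟩, hf⟩ := hf
  rw [RingHom.mem_ker]
  refine MvPolynomial.funext fun t => ?_
  let x : Fin n → K := fun i => ∏ j, t (some j) ^ m i j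
  have hx : x ∈ toricVariety K m := by
    rw [toricVariety, mem_zeroLocus_iff]
    intro p hp
    have : toricIdeal K m ≤ RingHom.ker (aeval x : MvPolynomial (Fin n) K →ₐ[K] K) := by
      refine Ideal.span_le.mpr ?_
      rintro _ ⟨a, b, hab, rfl⟩
      have hmon : ∀ a : Fin n →₀ ℕ, aeval x (monomial a (1 : K)) =
          ∏ j, t (some j) ^ (sDeg m a j) := fun a => by
        rw [aeval_monomial, Finsupp.prod_fintype _ _ (by simp)]
        simp_rw [x, ← Finset.prod_pow, ← pow_mul]
        rw [Finset.prod_comm]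
        simp [Finset.prod_pow_eq_pow_sum, sDeg, mul_comm]
      rw [SetLike.mem_coe, RingHom.mem_ker, map_sub, hmon, hmon, hab, sub_self]
    exact this hp
  have h0 := (eval_rep_mk_eq_zero_iff hk _).mp (hf _ ⟨x, hx, rfl⟩)
  have e : (fun i => (homGens m i).prod fun o k => t o ^ k) =
      fun i => t none * (Fin.cons 1 x : Fin (n + 1) → K) i := by
    funext i
    rw [Finsupp.prod_fintype _ _ (by simp), Fintype.prod_option, homGens_none, pow_one]
    congr 1
    refine Fin.cases ?_ (fun i => ?_) i
    · simp [homGens_zero_some]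
    · simp [homGens_succ_some, x]
  rw [eval_monomialHom, e, eval_mul_of_isHomogeneous hk, h0, mul_zero, map_zero]

theorem homIdeal_projToricVariety [Infinite K] :
    homIdeal (projToricVariety K m) = RingHom.ker (monomialHom K (homGens m)) := by
  rw [homIdeal, projToricVariety, projClosure, homVanishing_projZeroLocus_homVanishing]
  apply le_antisymm
  · exact Ideal.span_le.mpr fun f => homVanishing_subset_ker m
  · rw [ker_monomialHom]
    exact Ideal.span_mono (kerBinomials_subset_homVanishing m)

theorem mk_mem_projToricVariety_iff [Infinite K] {x : Fin (n + 1) → K} (hx : x ≠ 0) :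
    Projectivization.mk K x hx ∈ projToricVariety K m ↔
      ∀ f ∈ RingHom.ker (monomialHom K (homGens m)), eval x f = 0 := by
  rw [projToricVariety, projClosure, mk_mem_projZeroLocus_iff fun f hf => hf.1]
  refine ⟨fun h f hf => ?_, fun h f hf => h f (homVanishing_subset_ker m hf)⟩
  have : RingHom.ker (monomialHom K (homGens m)) ≤ RingHom.ker (eval x) := by
    rw [ker_monomialHom, Ideal.span_le]
    exact fun g hg => h g (kerBinomials_subset_homVanishing m hg)
  exact this hf

end HomogeneousToric

/-! ### The ideal of the extension and its defining relation. -/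

section Extension

variable {n d : ℕ} (m : Fin n → Fin d → ℕ) (ℓ : ℕ) (v : Fin d → ℕ)

/-- Multiplication by `ℓ` of all coordinates of an exponent except the total degree. -/
noncomputable def scaleExp : (Option (Fin d) →₀ ℕ) →ₗ[ℕ] (Option (Fin d) →₀ ℕ) where
  toFun e := Finsupp.equivFunOnFinite.symm fun o => o.elim 1 (fun _ => ℓ) * e o
  map_add' e e' := by ext o; simp [mul_add]
  map_smul' c e := by ext o; simp [mul_left_comm]

/-- The exponent `(1, v)`. -/
noncomputable def homExp : Option (Fin d) →₀ ℕ :=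
  Finsupp.equivFunOnFinite.symm fun o => o.elim 1 v

theorem scaleExp_none (e : Option (Fin d) →₀ ℕ) : scaleExp ℓ e none = e none := by
  simp [scaleExp]

theorem scaleExp_some (e : Option (Fin d) →₀ ℕ) (j) :
    scaleExp ℓ e (some j) = ℓ * e (some j) := by
  simp [scaleExp]

theorem homGens_extGens_castSucc (i : Fin (n + 1)) :
    homGens (extGens m ℓ v) i.castSucc = scaleExp ℓ (homGens m i) := by
  ext o
  rcases o with _ | j
  · rw [scaleExp_none, homGens_none, homGens_none]
  · rw [scaleExp_some]
    refine Fin.cases ?_ (fun i => ?_) i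
    · rw [Fin.castSucc_zero, homGens_zero_some, homGens_zero_some, mul_zero]
    · rw [← Fin.succ_castSucc, homGens_succ_some, homGens_succ_some]
      simp [extGens]

theorem homGens_extGens_last : homGens (extGens m ℓ v) (Fin.last (n + 1)) = homExp v := by
  ext o
  rcases o with _ | j
  · rfl
  · rw [← Fin.succ_last, homGens_succ_some]
    simp [extGens, homExp]

/-- Modulo `ℓ`, the component of `v` prime to `ℓ` determines `i`; the rest cancels since `ℓ > 0`. -/
theorem scaleExp_add_smul_eq_iff (hext : IsExtension m ℓ v) {e e' : Option (Fin d) →₀ ℕ}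
    {i j : Fin ℓ} :
    scaleExp ℓ e + (i : ℕ) • homExp v = scaleExp ℓ e' + (j : ℕ) • homExp v ↔ e = e' ∧ i = j := by
  refine ⟨fun h => ?_, by rintro ⟨rfl, rfl⟩; rfl⟩
  have hij : i = j := by
    obtain ⟨k, hk⟩ := hext.coprime
    have h' := DFunLike.congr_fun h (some k)
    simp only [Finsupp.add_apply, scaleExp_some, Finsupp.smul_apply, smul_eq_mul] at h'
    change ℓ * e (some k) + i * v k = ℓ * e' (some k) + j * v k at h'
    have h2 : i * v k ≡ j * v k [MOD ℓ] := by
      have := congrArg (· % ℓ) h'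
      simpa [Nat.ModEq, Nat.mul_add_mod] using this
    have h3 := Nat.ModEq.cancel_right_of_coprime hk h2
    exact Fin.ext (by rwa [Nat.ModEq, Nat.mod_eq_of_lt i.2, Nat.mod_eq_of_lt j.2] at h3)
  subst hij
  refine ⟨?_, rfl⟩
  have h' := add_right_cancel h
  ext o
  have := DFunLike.congr_fun h' o
  rcases o with _ | k
  · rwa [scaleExp_none, scaleExp_none] at this
  · rw [scaleExp_some, scaleExp_some] at this
    exact Nat.eq_of_mul_eq_mul_left hext.pos this

variable {K : Type*} [Field K]

/-- The inclusion of the coordinate ring of the ambient space in that of the extension. -/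
noncomputable def inclVars (K : Type*) [Field K] (n : ℕ) :
    MvPolynomial (Fin (n + 1)) K →ₐ[K] MvPolynomial (Fin (n + 2)) K :=
  rename Fin.castSucc

theorem monomialHom_inclVars_monomial_mul (a : Fin (n + 1) →₀ ℕ) (c : K) (i : ℕ) :
    monomialHom K (homGens (extGens m ℓ v)) (inclVars K n (monomial a c) * X (Fin.last _) ^ i) =
      monomial (scaleExp ℓ (Finsupp.linearCombination ℕ (homGens m) a) + i • homExp v) c := by
  have h : Finsupp.linearCombination ℕ (homGens (extGens m ℓ v)) (a.mapDomain Fin.castSucc) =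
      scaleExp ℓ (Finsupp.linearCombination ℕ (homGens m) a) := by
    rw [Finsupp.linearCombination_mapDomain, Finsupp.apply_linearCombination]
    congr 2
    funext i
    exact homGens_extGens_castSucc m ℓ v i
  rw [inclVars, rename_monomial, map_mul, map_pow, monomialHom_monomial, monomialHom_X, h,
    homGens_extGens_last, monomial_pow, monomial_mul, one_pow, mul_one]

theorem coeff_monomialHom_inclVars_mul (hext : IsExtension m ℓ v)
    (f : MvPolynomial (Fin (n + 1)) K) (i j : Fin ℓ) (e : Option (Fin d) →₀ ℕ) :
    coeff (scaleExp ℓ e + (j : ℕ) • homExp v)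
      (monomialHom K (homGens (extGens m ℓ v)) (inclVars K n f * X (Fin.last _) ^ (i : ℕ))) =
      if i = j then coeff e (monomialHom K (homGens m) f) else 0 := by
  classical
  induction f using MvPolynomial.induction_on' with
  | monomial a c =>
    rw [monomialHom_inclVars_monomial_mul, coeff_monomial, monomialHom_monomial, coeff_monomial]
    simp only [scaleExp_add_smul_eq_iff m ℓ v hext]
    split_ifs <;> tauto
  | add p q hp hq =>
    rw [map_add, add_mul, map_add, coeff_add, hp, hq, map_add, coeff_add]
    split_ifs <;> simp

/-- This is the independence of `1, y, …, y^(ℓ-1)`: the images of the summands have pairwise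
disjoint supports. -/
theorem mem_ker_of_sum_mem_ker (hext : IsExtension m ℓ v)
    {F : Fin ℓ → MvPolynomial (Fin (n + 1)) K}
    (hF : ∑ i, inclVars K n (F i) * X (Fin.last _) ^ (i : ℕ) ∈
      RingHom.ker (monomialHom K (homGens (extGens m ℓ v)))) (j : Fin ℓ) :
    F j ∈ RingHom.ker (monomialHom K (homGens m)) := by
  rw [RingHom.mem_ker, map_sum] at hF
  rw [RingHom.mem_ker]
  ext e
  have := congrArg (coeff (scaleExp ℓ e + (j : ℕ) • homExp v)) hF
  rw [coeff_sum] at this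
  simp_rw [coeff_monomialHom_inclVars_mul m ℓ v hext] at this
  simpa using this

theorem ker_le_comap_inclVars : RingHom.ker (monomialHom K (homGens m)) ≤
    (RingHom.ker (monomialHom K (homGens (extGens m ℓ v)))).comap (inclVars K n) := by
  rw [ker_monomialHom, Ideal.span_le]
  rintro _ ⟨a, b, hab, rfl⟩
  have h := monomialHom_inclVars_monomial_mul (K := K) m ℓ v
  simp only [SetLike.mem_coe, Ideal.mem_comap, RingHom.mem_ker, map_sub]
  have ha := h a 1 0
  have hb := h b 1 0
  rw [pow_zero, mul_one] at ha hb
  rw [ha, hb, hab, sub_self]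

/-- Division with remainder by a monic polynomial `yˡ - G`. -/
theorem exists_sub_sum_mem_span {n ℓ : ℕ} (hℓ : 0 < ℓ) (G : MvPolynomial (Fin (n + 1)) K)
    (f : MvPolynomial (Fin (n + 2)) K) : ∃ F : Fin ℓ → MvPolynomial (Fin (n + 1)) K,
      f - ∑ i, inclVars K n (F i) * X (Fin.last _) ^ (i : ℕ) ∈
        Ideal.span {X (Fin.last _) ^ ℓ - inclVars K n G} := by
  classical
  set J := Ideal.span {X (Fin.last (n + 1)) ^ ℓ - inclVars K n G}
  induction f using MvPolynomial.induction_on' with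
  | monomial a c =>
    let k := a (Fin.last _)
    let a₀ : Fin (n + 1) →₀ ℕ := Finsupp.equivFunOnFinite.symm fun i => a i.castSucc
    have e : monomial a c = inclVars K n (monomial a₀ c) * X (Fin.last _) ^ k := by
      rw [inclVars, rename_monomial, X_pow_eq_monomial, monomial_mul, mul_one]
      refine congrArg (fun e => monomial e c) (Finsupp.ext fun i => ?_)
      refine Fin.lastCases ?_ (fun i => ?_) i
      · rw [Finsupp.add_apply, Finsupp.mapDomain_of_notMem_range, zero_add, Finsupp.single_eq_same]
        rintro ⟨i, hi⟩
        exact Fin.castSucc_ne_last i hi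
      · rw [Finsupp.add_apply, Finsupp.mapDomain_apply (Fin.castSucc_injective _),
          Finsupp.single_eq_of_ne (Fin.castSucc_ne_last i), add_zero]
        rfl
    -- Replacing `y^ℓ` by `G` in `y^k = (y^ℓ)^(k / ℓ) * y^(k % ℓ)` leaves a single term.
    refine ⟨Pi.single ⟨k % ℓ, Nat.mod_lt _ hℓ⟩ (monomial a₀ c * G ^ (k / ℓ)), ?_⟩
    rw [Finset.sum_eq_single ⟨k % ℓ, Nat.mod_lt _ hℓ⟩ (fun i _ hi => by simp [hi]) (by simp),
      Pi.single_eq_same, e, map_mul, map_pow]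
    have hsub : (X (Fin.last (n + 1)) ^ ℓ) ^ (k / ℓ) - inclVars K n G ^ (k / ℓ) ∈ J :=
      J.mem_of_dvd (sub_dvd_pow_sub_pow _ _ _) (Ideal.mem_span_singleton_self _)
    have hk : (X (Fin.last (n + 1)) : MvPolynomial (Fin (n + 2)) K) ^ k =
        (X (Fin.last (n + 1)) ^ ℓ) ^ (k / ℓ) * X (Fin.last (n + 1)) ^ (k % ℓ) := by
      rw [← pow_mul, ← pow_add, Nat.div_add_mod]
    have := J.mul_mem_left
      (inclVars K n (monomial a₀ c) * X (Fin.last (n + 1)) ^ (k % ℓ)) hsub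
    convert this using 1
    rw [hk]
    ring
  | add p q hp hq =>
    obtain ⟨F, hF⟩ := hp
    obtain ⟨F', hF'⟩ := hq
    refine ⟨F + F', ?_⟩
    have := add_mem hF hF'
    convert this using 1
    simp only [Pi.add_apply, map_add, add_mul, Finset.sum_add_distrib]
    ring

theorem exists_homogeneous_relation (hext : IsExtension m ℓ v) (hδ : delta m v ≤ ℓ) :
    ∃ a : Fin (n + 1) →₀ ℕ, a.degree = ℓ ∧
      X (Fin.last _) ^ ℓ - inclVars K n (monomial a 1) ∈
        RingHom.ker (monomialHom K (homGens (extGens m ℓ v))) := by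
  obtain ⟨s, hs, hN⟩ : delta m v ∈
      {N | ∃ s : Fin n → ℕ, v = ∑ i, s i • m i ∧ N = ∑ i, s i} := by
    -- The infimum is attained because `v ∈ S` makes the set nonempty.
    refine Nat.sInf_mem ?_
    obtain ⟨s, hs⟩ := AddSubmonoid.exists_of_mem_closure_range _ _ hext.mem
    exact ⟨_, s, hs, rfl⟩
  -- The power of `x₀` raises the degree from `δ(v)` to `ℓ`; `hδ` keeps the subtraction from
  -- truncating.
  let a : Fin (n + 1) →₀ ℕ := Finsupp.equivFunOnFinite.symm (Fin.cons (ℓ - delta m v) s)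
  have hadeg : a.degree = ℓ := by
    rw [Finsupp.degree_eq_sum, Fin.sum_univ_succ]
    simp only [a, Finsupp.equivFunOnFinite_symm_apply_apply, Fin.cons_zero, Fin.cons_succ]
    omega
  refine ⟨a, hadeg, ?_⟩
  have h := monomialHom_inclVars_monomial_mul (K := K) m ℓ v
  have ha := h a 1 0
  have hb := h 0 1 ℓ
  rw [pow_zero, mul_one] at ha
  rw [show (monomial 0 1 : MvPolynomial (Fin (n + 1)) K) = 1 from rfl, map_one, one_mul] at hb
  rw [RingHom.mem_ker, map_sub, ha, hb, sub_eq_zero]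
  refine congrArg (fun e => monomial e (1 : K)) (Finsupp.ext fun o => ?_)
  rcases o with _ | j
  · simp [scaleExp_none, linearCombination_homGens_none, hadeg, homExp]
  · simp [scaleExp_some, linearCombination_homGens_some, homExp, a, hs]

/-- Modulo the relation, an element of the larger kernel is `∑ Fᵢ yⁱ`, and independence puts every
`Fᵢ` in the smaller kernel. -/
theorem forall_mem_ker_extGens_eval_eq_zero_iff (hext : IsExtension m ℓ v)
    {G : MvPolynomial (Fin (n + 1)) K}
    (hG : X (Fin.last _) ^ ℓ - inclVars K n G ∈
      RingHom.ker (monomialHom K (homGens (extGens m ℓ v)))) (w : Fin (n + 2) → K) :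
    (∀ f ∈ RingHom.ker (monomialHom K (homGens (extGens m ℓ v))), eval w f = 0) ↔
      (∀ f ∈ RingHom.ker (monomialHom K (homGens m)), eval (w ∘ Fin.castSucc) f = 0) ∧
        eval w (X (Fin.last _) ^ ℓ - inclVars K n G) = 0 := by
  have hincl : ∀ f, eval w (inclVars K n f) = eval (w ∘ Fin.castSucc) f := fun f =>
    eval_rename _ _ _
  refine ⟨fun h => ⟨fun f hf => ?_, h _ hG⟩, fun ⟨h, h'⟩ f hf => ?_⟩
  · rw [← hincl]
    exact h _ (ker_le_comap_inclVars m ℓ v hf)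
  · obtain ⟨F, hF⟩ := exists_sub_sum_mem_span hext.pos G f
    have h0 := sub_mem hf ((Ideal.span_singleton_le_iff_mem _).mpr hG hF)
    rw [sub_sub_cancel] at h0
    have h1 : eval w (f - ∑ i, inclVars K n (F i) * X (Fin.last _) ^ (i : ℕ)) = 0 :=
      (Ideal.span_singleton_le_iff_mem (RingHom.ker (eval w))).mpr h' hF
    have h2 : eval w (∑ i, inclVars K n (F i) * X (Fin.last _) ^ (i : ℕ)) = 0 := by
      rw [map_sum]
      refine Finset.sum_eq_zero fun i _ => ?_
      rw [map_mul, hincl, h _ (mem_ker_of_sum_mem_ker m ℓ v hext h0 i), zero_mul]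
    rwa [map_sub, h2, sub_zero] at h1

end Extension

/-! ### The free extension of coordinate rings and the three conclusions. -/

section CoordinateRing

variable {K : Type*} [Field K] [Infinite K] {n d : ℕ} (m : Fin n → Fin d → ℕ) (ℓ : ℕ)
  (v : Fin d → ℕ)

/-- The homomorphism of homogeneous coordinate rings from `V_{S̄}` to its extension. -/
noncomputable def coordRingHom : HomCoordRing (projToricVariety K m) →+*
    HomCoordRing (projToricVariety K (extGens m ℓ v)) :=
  Ideal.quotientMap _ (inclVars K n).toRingHom <| by
    rw [homIdeal_projToricVariety, homIdeal_projToricVariety]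
    exact ker_le_comap_inclVars m ℓ v

noncomputable instance coordRingAlgebra : Algebra (HomCoordRing (projToricVariety K m))
    (HomCoordRing (projToricVariety K (extGens m ℓ v))) :=
  (coordRingHom m ℓ v).toAlgebra

theorem algebraMap_coordRing_mk (f : MvPolynomial (Fin (n + 1)) K) :
    algebraMap (HomCoordRing (projToricVariety K m))
      (HomCoordRing (projToricVariety K (extGens m ℓ v))) (Ideal.Quotient.mk _ f) =
      Ideal.Quotient.mk _ (inclVars K n f) := rfl

theorem mk_eq_zero_iff (f : MvPolynomial (Fin (n + 1)) K) :
    Ideal.Quotient.mk (homIdeal (projToricVariety K m)) f = 0 ↔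
      f ∈ RingHom.ker (monomialHom K (homGens m)) := by
  rw [Ideal.Quotient.eq_zero_iff_mem, homIdeal_projToricVariety]

theorem sum_smul_pow_eq_mk (F : Fin ℓ → MvPolynomial (Fin (n + 1)) K) :
    ∑ i, (Ideal.Quotient.mk _ (F i) : HomCoordRing (projToricVariety K m)) •
      (Ideal.Quotient.mk _ (X (Fin.last _)) :
        HomCoordRing (projToricVariety K (extGens m ℓ v))) ^ (i : ℕ) =
      Ideal.Quotient.mk _ (∑ i, inclVars K n (F i) * X (Fin.last _) ^ (i : ℕ)) := by
  simp_rw [map_sum, map_mul, map_pow, Algebra.smul_def, algebraMap_coordRing_mk]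

theorem exists_root_basis (hext : IsExtension m ℓ v) (hδ : delta m v ≤ ℓ) :
    ∃ (y : HomCoordRing (projToricVariety K (extGens m ℓ v)))
      (g : HomCoordRing (projToricVariety K m))
      (b : Module.Basis (Fin ℓ) (HomCoordRing (projToricVariety K m))
        (HomCoordRing (projToricVariety K (extGens m ℓ v)))),
      (∀ i, b i = y ^ (i : ℕ)) ∧ y ^ ℓ = algebraMap _ _ g := by
  obtain ⟨a, -, ha⟩ := exists_homogeneous_relation (K := K) m ℓ v hext hδ
  let y : HomCoordRing (projToricVariety K (extGens m ℓ v)) :=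
    Ideal.Quotient.mk _ (X (Fin.last _))
  have hli : LinearIndependent (HomCoordRing (projToricVariety K m))
      fun i : Fin ℓ => y ^ (i : ℕ) := by
    rw [Fintype.linearIndependent_iff]
    intro c hc i
    choose F hF using fun i => Ideal.Quotient.mk_surjective (c i)
    obtain rfl : (fun i => Ideal.Quotient.mk _ (F i)) = c := funext hF
    rw [sum_smul_pow_eq_mk, mk_eq_zero_iff] at hc
    exact (mk_eq_zero_iff m _).mpr (mem_ker_of_sum_mem_ker m ℓ v hext hc i)
  have hspan : ⊤ ≤ Submodule.span (HomCoordRing (projToricVariety K m))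
      (Set.range fun i : Fin ℓ => y ^ (i : ℕ)) := by
    intro z _
    obtain ⟨f, rfl⟩ := Ideal.Quotient.mk_surjective z
    obtain ⟨F, hF⟩ := exists_sub_sum_mem_span hext.pos (monomial a 1) f
    have h0 := (Ideal.span_singleton_le_iff_mem _).mpr ha hF
    rw [← mk_eq_zero_iff, map_sub, sub_eq_zero, ← sum_smul_pow_eq_mk] at h0
    rw [h0]
    exact Submodule.sum_mem _ fun i _ =>
      Submodule.smul_mem _ _ (Submodule.subset_span ⟨i, rfl⟩)
  refine ⟨y, Ideal.Quotient.mk _ (monomial a 1), .mk hli hspan, fun i => by simp, ?_⟩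
  rw [algebraMap_coordRing_mk, ← map_pow, ← sub_eq_zero, ← map_sub, mk_eq_zero_iff]
  exact ha

theorem ringKrullDim_homCoordRing_extGens (hext : IsExtension m ℓ v) (hδ : delta m v ≤ ℓ) :
    ringKrullDim (HomCoordRing (projToricVariety K (extGens m ℓ v))) =
      ringKrullDim (HomCoordRing (projToricVariety K m)) := by
  obtain ⟨y, g, b, -⟩ := exists_root_basis (K := K) m ℓ v hext hδ
  have : Module.Free (HomCoordRing (projToricVariety K m))
    (HomCoordRing (projToricVariety K (extGens m ℓ v))) := .of_basis b
  have : Module.Finite (HomCoordRing (projToricVariety K m))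
    (HomCoordRing (projToricVariety K (extGens m ℓ v))) := .of_basis b
  -- A nonzero free module is faithfully flat.
  have : Nontrivial (HomCoordRing (projToricVariety K (extGens m ℓ v))) := by
    rw [Ideal.Quotient.nontrivial_iff, homIdeal_projToricVariety]
    exact RingHom.ker_ne_top _
  exact ringKrullDim_eq_of_faithfullyFlat_of_isIntegral

theorem isSetTheoreticCI_extGens (hext : IsExtension m ℓ v) (hδ : delta m v ≤ ℓ)
    (h : IsSetTheoreticCI (projToricVariety K m)) :
    IsSetTheoreticCI (projToricVariety K (extGens m ℓ v)) := by
  obtain ⟨c, f, hf, hV, hdim⟩ := h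
  obtain ⟨a, hdeg, ha⟩ := exists_homogeneous_relation (K := K) m ℓ v hext hδ
  let f' : Fin (c + 1) → MvPolynomial (Fin (n + 2)) K :=
    Fin.snoc (α := fun _ => MvPolynomial (Fin (n + 2)) K) (fun i => inclVars K n (f i))
      (X (Fin.last _) ^ ℓ - inclVars K n (monomial a 1))
  have hcast : ∀ i : Fin c, f' i.castSucc = inclVars K n (f i) := fun i => by simp [f']
  have hlast : f' (Fin.last c) = X (Fin.last _) ^ ℓ - inclVars K n (monomial a 1) := by
    simp [f']
  have hhom : ∀ i, ∃ k, (f' i).IsHomogeneous k := by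
    intro i
    refine Fin.lastCases ?_ (fun i => ?_) i
    · rw [hlast]
      refine ⟨ℓ, .sub ?_ (.rename_isHomogeneous (isHomogeneous_monomial _ hdeg))⟩
      simpa using (isHomogeneous_X K (Fin.last (n + 1))).pow ℓ
    · obtain ⟨k, hk⟩ := hf i
      rw [hcast]
      exact ⟨k, hk.rename_isHomogeneous⟩
  refine ⟨c + 1, f', hhom, ?_, ?_⟩
  · ext p
    obtain ⟨w, hw, rfl⟩ : ∃ w, ∃ hw : w ≠ 0, Projectivization.mk K w hw = p :=
      ⟨p.rep, p.rep_nonzero, p.mk_rep⟩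
    rw [mk_mem_projToricVariety_iff, forall_mem_ker_extGens_eval_eq_zero_iff m ℓ v hext ha,
      mk_mem_projZeroLocus_iff (by rintro _ ⟨i, rfl⟩; exact hhom i), Set.forall_mem_range,
      Fin.forall_fin_succ']
    simp_rw [hcast, hlast]
    refine and_congr_left fun hrel => ?_
    -- Projection from `(0 : ⋯ : 0 : 1)` is defined on the locus: there the monomial of degree `ℓ >
    -- 0` vanishes, and the relation would force the last coordinate to vanish too.
    have hx : w ∘ Fin.castSucc ≠ 0 := by
      intro hx
      have hG : eval w (inclVars K n (monomial a (1 : K))) = 0 := by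
        refine (eval_rename _ _ _).trans ?_
        rw [hx]
        have := eval_mul_of_isHomogeneous (isHomogeneous_monomial (1 : K) hdeg) 0 0
        rw [zero_pow hext.pos.ne', zero_mul] at this
        simpa using this
      rw [map_sub, hG, sub_zero, map_pow, eval_X] at hrel
      refine hw (funext fun i => ?_)
      refine Fin.lastCases (eq_zero_of_pow_eq_zero hrel) (fun i => ?_) i
      exact congrFun hx i
    rw [← mk_mem_projToricVariety_iff m hx, hV,
      mk_mem_projZeroLocus_iff (by rintro _ ⟨i, rfl⟩; exact hf i), Set.forall_mem_range]
    exact forall_congr' fun i => by rw [inclVars, eval_rename]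
  · rw [ringKrullDim_homCoordRing_extGens m ℓ v hext hδ, Nat.cast_succ, add_right_comm, hdim]
    norm_cast

theorem isArithCM_extGens (hext : IsExtension m ℓ v) (hδ : delta m v ≤ ℓ)
    (h : IsArithCM (projToricVariety K m)) :
    IsArithCM (projToricVariety K (extGens m ℓ v)) := by
  obtain ⟨y, g, b, -⟩ := exists_root_basis (K := K) m ℓ v hext hδ
  have : Module.Free (HomCoordRing (projToricVariety K m))
    (HomCoordRing (projToricVariety K (extGens m ℓ v))) := .of_basis b
  have : Module.Finite (HomCoordRing (projToricVariety K m))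
    (HomCoordRing (projToricVariety K (extGens m ℓ v))) := .of_basis b
  exact isCohenMacaulay_of_flat_of_isIntegral h

theorem isArithGorenstein_extGens (hext : IsExtension m ℓ v) (hδ : delta m v ≤ ℓ)
    (h : IsArithGorenstein (projToricVariety K m)) :
    IsArithGorenstein (projToricVariety K (extGens m ℓ v)) := by
  obtain ⟨y, g, b, hb, hy⟩ := exists_root_basis (K := K) m ℓ v hext hδ
  exact isGorenstein_of_root hext.pos b hb hy h

end CoordinateRing

end ToricExt

theorem mainTheorem4 {K : Type*} [Field K] [IsAlgClosed K] {n d : ℕ}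
    (m : Fin n → Fin d → ℕ) (ℓ : ℕ) (v : Fin d → ℕ)
    (hext : ToricExt.IsExtension m ℓ v) (hδ : ToricExt.delta m v ≤ ℓ) :
    (ToricExt.IsSetTheoreticCI (ToricExt.projToricVariety K m) →
      ToricExt.IsSetTheoreticCI (ToricExt.projToricVariety K (ToricExt.extGens m ℓ v))) ∧
    (ToricExt.IsArithCM (ToricExt.projToricVariety K m) →
      ToricExt.IsArithCM (ToricExt.projToricVariety K (ToricExt.extGens m ℓ v))) ∧
    (ToricExt.IsArithGorenstein (ToricExt.projToricVariety K m) →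
      ToricExt.IsArithGorenstein (ToricExt.projToricVariety K (ToricExt.extGens m ℓ v))) := by
  exact ⟨ToricExt.isSetTheoreticCI_extGens m ℓ v hext hδ,
    ToricExt.isArithCM_extGens m ℓ v hext hδ, ToricExt.isArithGorenstein_extGens m ℓ v hext hδ⟩
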